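/- Let $R$ be an associative ring with unit and let $M$ be an $R$-module (all modules are unital and on the same side). Let $\sigma(M)$ be the class of modules subgenerated by $M$, i.e. isomorphic to a submodule of a quotient of a direct sum of copies of $M$. For modules $P,N$, call $P$ almost $N$-projective if for every submodule $K\subseteq N$ with natural map $g:N\to N/K$ and every homomorphism $f:P\to N/K$, either there is a homomorphism $h:P\to N$ with $f=gh$, or there are a nonzero direct summand $N'$ of $N$ and a homomorphism $h':N'\to P$ with $g|_{N'}=fh'$. Call $P$ almost projective in $\sigma(M)$ if it is almost $N$-projective for every $N\in\sigma(M)$. A module $A$ is $M$-injective if every homomorphism from a submodule of $M$ to $A$ extends to $M$. A submodule $B$ of $N$ is small if $B+C=N$ implies $C=N$ for every submodule $C$ of $N$, and $N$ is an $I_0$-module if every non-small submodule of $N$ contains a nonzero direct summand of $N$. Then the following conditions are equivalent: 1. Every simple module in $\sigma(M)$ is almost projective in $\sigma(M)$. 2. Every module in $\sigma(M)$ is semisimple or contains a nonzero $M$-injective submodule. 3. Every module in $\sigma(M)$ is an $I_0$-module. -/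

import Mathlib

universe u

section Definitions

variable (R : Type u) [Ring R]

/-- `N` belongs to `σ(M)`: it is subgenerated by `M`, i.e. isomorphic to a submodule of
a quotient of a direct sum of copies of `M`. -/
def IsSubgenerated (M N : Type u) [AddCommGroup M] [Module R M]
    [AddCommGroup N] [Module R N] : Prop :=
  ∃ (ι : Type u) (K : Submodule R (ι →₀ M)) (j : N →ₗ[R] ((ι →₀ M) ⧸ K)),
    Function.Injective j

/-- `A` is `M`-injective: every homomorphism from a submodule of `M` to `A` extends to `M`. -/
def IsRelInjective (M A : Type u) [AddCommGroup M] [Module R M]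
    [AddCommGroup A] [Module R A] : Prop :=
  ∀ (M' : Submodule R M) (f : M' →ₗ[R] A), ∃ g : M →ₗ[R] A, g ∘ₗ M'.subtype = f

/-- `P` is almost `N`-projective. Direct summands of `N` are the submodules having a complement
in the lattice of submodules. -/
def IsAlmostRelProjective (N P : Type u) [AddCommGroup N] [Module R N]
    [AddCommGroup P] [Module R P] : Prop :=
  ∀ (K : Submodule R N) (f : P →ₗ[R] (N ⧸ K)),
    (∃ h : P →ₗ[R] N, K.mkQ ∘ₗ h = f) ∨
    (∃ N' : Submodule R N, N' ≠ ⊥ ∧ IsComplemented N' ∧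
      ∃ h' : N' →ₗ[R] P, K.mkQ ∘ₗ N'.subtype = f ∘ₗ h')

/-- `P` is almost projective in the category `σ(M)`: it is almost `N`-projective for every
module `N` in `σ(M)`. -/
def IsAlmostProjectiveIn (M P : Type u) [AddCommGroup M] [Module R M]
    [AddCommGroup P] [Module R P] : Prop :=
  ∀ (N : Type u) [AddCommGroup N] [Module R N],
    IsSubgenerated R M N → IsAlmostRelProjective R N P

variable {R} in
/-- `B` is a small (superfluous) submodule of `N`. -/
def IsSmallSubmodule {N : Type u} [AddCommGroup N] [Module R N] (B : Submodule R N) : Prop :=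
  ∀ C : Submodule R N, B ⊔ C = ⊤ → C = ⊤

/-- `N` is an `I₀`-module: every non-small submodule contains a nonzero direct summand of `N`. -/
def IsIZeroModule (N : Type u) [AddCommGroup N] [Module R N] : Prop :=
  ∀ B : Submodule R N, ¬ IsSmallSubmodule B →
    ∃ D : Submodule R N, D ≤ B ∧ D ≠ ⊥ ∧ IsComplemented D

end Definitions

/-! Condition 2 is the hub. Inside σ(M), an M-injective submodule always splits off
(`IsRelInjective.isComplemented`), so under 2 each submodule is semisimple or contains a nonzero
summand of the ambient module; this gives 1 and 3.

Conversely, a non-semisimple module contains some T with a simple quotient T/K that does not split.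
Embed T in an M-injective E in σ(M). Condition 1, applied to T/K → E/K, and condition 3, applied to
the graph of T → T/K in E × T/K, each produce either a forbidden section or a nonzero M-injective
submodule of T. -/

section SubgeneratedModules

variable {R : Type u} [Ring R] {M : Type u} [AddCommGroup M] [Module R M]

/-! ### Closure properties of σ(M). -/

namespace IsSubgenerated

variable {N : Type u} [AddCommGroup N] [Module R N] {N' : Type u} [AddCommGroup N'] [Module R N']

theorem of_surjective_of_injective {ι Q : Type u} [AddCommGroup Q] [Module R Q]
    (p : (ι →₀ M) →ₗ[R] Q) (hp : Function.Surjective p) (j : N →ₗ[R] Q)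
    (hj : Function.Injective j) : IsSubgenerated R M N :=
  ⟨ι, LinearMap.ker p, (p.quotKerEquivOfSurjective hp).symm.toLinearMap ∘ₗ j,
    (p.quotKerEquivOfSurjective hp).symm.injective.comp hj⟩

theorem of_injective (hN : IsSubgenerated R M N) (i : N' →ₗ[R] N) (hi : Function.Injective i) :
    IsSubgenerated R M N' := by
  obtain ⟨ι, K, j, hj⟩ := hN
  exact ⟨ι, K, j ∘ₗ i, hj.comp hi⟩

theorem submodule (hN : IsSubgenerated R M N) (A : Submodule R N) : IsSubgenerated R M A :=
  hN.of_injective A.subtype A.injective_subtype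

theorem quotient (hN : IsSubgenerated R M N) (A : Submodule R N) :
    IsSubgenerated R M (N ⧸ A) := by
  obtain ⟨ι, K, j, hj⟩ := hN
  refine of_surjective_of_injective ((A.map j).mkQ ∘ₗ K.mkQ)
    ((A.map j).mkQ_surjective.comp K.mkQ_surjective)
    (A.mapQ (A.map j) j (Submodule.le_comap_map j A)) ?_
  rw [← LinearMap.ker_eq_bot, Submodule.ker_mapQ, Submodule.comap_map_eq_of_injective hj,
    Submodule.mkQ_map_self]

theorem prod (hN : IsSubgenerated R M N) (hN' : IsSubgenerated R M N') :
    IsSubgenerated R M (N × N') := by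
  obtain ⟨ι, K, j, hj⟩ := hN
  obtain ⟨κ, L, k, hk⟩ := hN'
  refine of_surjective_of_injective
    ((K.mkQ.prodMap L.mkQ) ∘ₗ
      (Finsupp.sumFinsuppLEquivProdFinsupp (M := M) (α := ι) (β := κ) R).toLinearMap)
    ?_ (j.prodMap k) (hj.prodMap hk)
  exact (K.mkQ_surjective.prodMap L.mkQ_surjective).comp (LinearEquiv.surjective _)

end IsSubgenerated

/-! ### Relative injectivity and splitting in σ(M). -/

namespace IsRelInjective

variable {A : Type u} [AddCommGroup A] [Module R A]

theorem of_retract {E : Type u} [AddCommGroup E] [Module R E] (hE : IsRelInjective R M E)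
    (i : A →ₗ[R] E) (r : E →ₗ[R] A) (hri : r ∘ₗ i = LinearMap.id) : IsRelInjective R M A := by
  intro M' f
  obtain ⟨g, hg⟩ := hE M' (i ∘ₗ f)
  exact ⟨r ∘ₗ g, by rw [LinearMap.comp_assoc, hg, ← LinearMap.comp_assoc, hri, LinearMap.id_comp]⟩

theorem of_isComplemented {E : Type u} [AddCommGroup E] [Module R E] (hE : IsRelInjective R M E)
    {D : Submodule R E} (hD : IsComplemented D) : IsRelInjective R M D := by
  obtain ⟨C, hC⟩ := hD
  exact hE.of_retract D.subtype (D.projectionOnto C hC) (by ext; simp)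

/-- A maximal extension is defined on each copy of `M`: otherwise `M`-injectivity extends it to that
copy, and the two maps glue. -/
theorem finsupp (hA : IsRelInjective R M A) (ι : Type u) : IsRelInjective R (ι →₀ M) A := by
  intro X f
  obtain ⟨g, hfg, hg⟩ := zorn_le_nonempty_Ici₀ (⟨X, f⟩ : (ι →₀ M) →ₗ.[R] A)
    (fun c _ hc y hy => ⟨LinearPMap.sSup c hc.directedOn,
      fun z hz => LinearPMap.le_sSup hc.directedOn hz⟩) ⟨X, f⟩ le_rfl
  have htop : g.domain = ⊤ := by
    rw [eq_top_iff, ← Finsupp.iSup_lsingle_range, iSup_le_iff]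
    intro i
    obtain ⟨k, hk⟩ := hA (g.domain.comap (Finsupp.lsingle i))
      (g.toFun ∘ₗ (Finsupp.lsingle i).restrict fun _ hx => hx)
    let s : (ι →₀ M) →ₗ.[R] A :=
      ⟨LinearMap.range (Finsupp.lsingle i : M →ₗ[R] ι →₀ M),
        k ∘ₗ Finsupp.lapply i ∘ₗ Submodule.subtype _⟩
    have hs : ∀ (x : g.domain) (y : s.domain), (x : ι →₀ M) = y → g x = s y := by
      rintro ⟨x, hx⟩ ⟨_, m, rfl⟩ (rfl : x = _)
      have := LinearMap.congr_fun hk ⟨m, hx⟩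
      have hm : Finsupp.lapply (R := R) i (Finsupp.lsingle (R := R) i m) = m := by simp
      exact this.symm.trans (congrArg k hm.symm)
    exact (g.right_le_sup s hs).1.trans (hg (g.left_le_sup s hs)).1
  refine ⟨g.toFun ∘ₗ LinearMap.codRestrict g.domain LinearMap.id fun x => htop ▸ trivial, ?_⟩
  ext x
  exact (hfg.2 (x := x) rfl).symm

/-- An `M`-injective submodule of a module subgenerated by `M` is a direct summand. -/
theorem isComplemented {N : Type u} [AddCommGroup N] [Module R N] (hN : IsSubgenerated R M N)
    {A : Submodule R N} (hA : IsRelInjective R M A) : IsComplemented A := by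
  obtain ⟨ι, K, j, hj⟩ := hN
  let i : A →ₗ[R] (ι →₀ M) ⧸ K := j ∘ₗ A.subtype
  have hi : Function.Injective i := hj.comp A.injective_subtype
  let e := LinearEquiv.ofInjective i hi
  obtain ⟨g, hg⟩ := hA.finsupp ι ((LinearMap.range i).comap K.mkQ)
    (e.symm.toLinearMap ∘ₗ K.mkQ.restrict fun _ hx => hx)
  -- `K` lies in the preimage of `A`, where `g` is prescribed and vanishes on `K`; hence `g`
  -- descends to a projection onto `A`.
  have hgK : K ≤ LinearMap.ker g := by
    intro x hx
    have hx0 : K.mkQ x = 0 := by simpa using hx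
    have hxi : x ∈ (LinearMap.range i).comap K.mkQ := by
      rw [Submodule.mem_comap, hx0]; exact zero_mem _
    have := LinearMap.congr_fun hg ⟨x, hxi⟩
    rw [LinearMap.mem_ker]
    refine this.trans ?_
    change e.symm _ = 0
    rw [LinearEquiv.map_eq_zero_iff]
    exact Subtype.ext hx0
  refine ⟨_, LinearMap.isCompl_of_proj (f := K.liftQ g hgK ∘ₗ j) fun a => ?_⟩
  obtain ⟨x, hx⟩ := K.mkQ_surjective (j a)
  have hxi : x ∈ (LinearMap.range i).comap K.mkQ := ⟨a, hx.symm⟩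
  rw [LinearMap.comp_apply, ← hx]
  refine (LinearMap.congr_fun hg ⟨x, hxi⟩).trans ?_
  change e.symm _ = a
  rw [LinearEquiv.symm_apply_eq]
  exact Subtype.ext hx

end IsRelInjective

/-- The class of modules subgenerated by `M` has enough `M`-injective modules. -/
theorem IsSubgenerated.exists_isRelInjective {N : Type u} [AddCommGroup N] [Module R N]
    (hN : IsSubgenerated R M N) :
    ∃ (E : Type u) (_ : AddCommGroup E) (_ : Module R E) (e : N →ₗ[R] E),
      Function.Injective e ∧ IsSubgenerated R M E ∧ IsRelInjective R M E := by
  obtain ⟨I, hI, φ, hφ⟩ := CategoryTheory.EnoughInjectives.presentation (ModuleCat.of R N)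
  have hI' : Module.Injective R I := (Module.injective_iff_injective_object R I).mpr hI
  let i : N →ₗ[R] I := φ.hom
  have hi : Function.Injective i := (ModuleCat.mono_iff_injective φ).mp hφ
  -- The range of `p` is the trace of `M` in the injective module `I`; every map `M → I` lands in
  -- it.
  let p : ((M →ₗ[R] I) →₀ M) →ₗ[R] I := Finsupp.lsum ℕ fun f => f
  have hp : ∀ (f : M →ₗ[R] I) (m : M), f m ∈ LinearMap.range p :=
    fun f m => ⟨Finsupp.single f m, by simp [p]⟩
  obtain ⟨ι, K, j, hj⟩ := hN
  obtain ⟨k, hk⟩ := hI'.out j hj i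
  have hkp : ∀ y, k (K.mkQ y) ∈ LinearMap.range p := by
    intro y
    induction y using Finsupp.induction_linear with
    | zero => rw [map_zero, map_zero]; exact zero_mem _
    | add a b ha hb => rw [map_add, map_add]; exact add_mem ha hb
    | single a m => exact hp (k ∘ₗ K.mkQ ∘ₗ Finsupp.lsingle a) m
  have hik : ∀ x, i x ∈ LinearMap.range p := by
    intro x
    obtain ⟨y, hy⟩ := K.mkQ_surjective (j x)
    rw [← hk, ← hy]
    exact hkp y
  refine ⟨LinearMap.range p, inferInstance, inferInstance, i.codRestrict _ hik, ?_, ?_, ?_⟩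
  · exact (LinearMap.injective_codRestrict_iff ..).mpr hi
  · exact .of_surjective_of_injective p.rangeRestrict p.surjective_rangeRestrict LinearMap.id
      Function.injective_id
  · intro M' f
    obtain ⟨g, hg⟩ := hI'.out M'.subtype M'.injective_subtype ((LinearMap.range p).subtype ∘ₗ f)
    exact ⟨g.codRestrict _ (hp g), LinearMap.ext fun x => Subtype.ext (hg x)⟩

/-- A module that is not semisimple has a submodule with a simple quotient onto which it
does not split. -/
theorem exists_simple_quotient_not_split {N : Type u} [AddCommGroup N] [Module R N]
    (hN : ¬ IsSemisimpleModule R N) :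
    ∃ (T : Submodule R N) (K : Submodule R T), IsSimpleModule R (T ⧸ K) ∧
      ¬ ∃ h : (T ⧸ K) →ₗ[R] T, K.mkQ ∘ₗ h = LinearMap.id := by
  set Soc := sSup {m : Submodule R N | IsSimpleModule R m} with hSoc
  have hne : Soc ≠ ⊤ := fun h => hN (.of_sSup_simples_eq_top h)
  obtain ⟨x, -, hx⟩ := SetLike.exists_of_lt hne.lt_top
  let T := Submodule.span R {x}
  have hxT : x ∈ T := Submodule.mem_span_singleton_self x
  -- `T` is cyclic and not inside the socle, so `Soc ∩ T` lies in a maximal `K`. A section of `T →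
  -- T/K` would have simple image, inside `Soc ∩ T ≤ K`, and so be zero.
  have hT : Soc.comap T.subtype ≠ ⊤ := fun h =>
    hx (show (⟨x, hxT⟩ : T) ∈ Soc.comap T.subtype from h ▸ trivial)
  obtain ⟨K, hK, hle⟩ := (eq_top_or_exists_le_coatom (Soc.comap T.subtype)).resolve_left hT
  have hS : IsSimpleModule R (T ⧸ K) := isSimpleModule_iff_isCoatom.mpr hK
  refine ⟨T, K, hS, ?_⟩
  rintro ⟨h, hh⟩
  have hinj : Function.Injective (T.subtype ∘ₗ h) :=
    T.injective_subtype.comp (Function.LeftInverse.injective (LinearMap.congr_fun hh))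
  have hsimple : IsSimpleModule R (LinearMap.range (T.subtype ∘ₗ h)) :=
    .congr (LinearEquiv.ofInjective _ hinj).symm
  have hrange : LinearMap.range (T.subtype ∘ₗ h) ≤ Soc := le_sSup hsimple
  have := hS.nontrivial
  obtain ⟨s, hs⟩ := exists_ne (0 : T ⧸ K)
  apply hs
  rw [← LinearMap.id_apply (R := R) s, ← hh, LinearMap.comp_apply, Submodule.mkQ_apply,
    Submodule.Quotient.mk_eq_zero]
  exact hle (hrange ⟨s, rfl⟩)

variable {T E : Type u} [AddCommGroup T] [Module R T] [AddCommGroup E] [Module R E]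

theorem IsRelInjective.exists_submodule_of_injective {A : Type u} [AddCommGroup A] [Module R A]
    [Nontrivial A] (hA : IsRelInjective R M A) (i : A →ₗ[R] T) (hi : Function.Injective i) :
    ∃ B : Submodule R T, B ≠ ⊥ ∧ IsRelInjective R M B := by
  let e := LinearEquiv.ofInjective i hi
  refine ⟨LinearMap.range i, ?_, hA.of_retract e.symm.toLinearMap e.toLinearMap (by ext; simp)⟩
  rw [Ne, LinearMap.range_eq_bot]
  rintro rfl
  obtain ⟨a, ha⟩ := exists_ne (0 : A)
  exact ha (hi rfl)

theorem exists_section_or_of_isAlmostRelProjective (hE : IsRelInjective R M E)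
    {e : T →ₗ[R] E} (he : Function.Injective e) {K : Submodule R T}
    (hP : IsAlmostRelProjective R E (T ⧸ K)) :
    (∃ h : (T ⧸ K) →ₗ[R] T, K.mkQ ∘ₗ h = LinearMap.id) ∨
      ∃ A : Submodule R T, A ≠ ⊥ ∧ IsRelInjective R M A := by
  let e' := LinearEquiv.ofInjective e he
  -- The image of `T` is the full preimage of `T/K` in `E`, so a lift of `T/K`, or a summand mapping
  -- through `T/K`, lies in `T`.
  have hmem : ∀ (y : E) (s : T ⧸ K),
      (K.map e).mkQ y = K.mapQ (K.map e) e (Submodule.le_comap_map e K) s →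
        ∃ t : T, e t = y ∧ K.mkQ t = s := by
    intro y s hys
    obtain ⟨t, rfl⟩ := K.mkQ_surjective s
    rw [Submodule.mkQ_apply, Submodule.mkQ_apply, Submodule.mapQ_apply, Submodule.Quotient.eq] at hys
    obtain ⟨k, hk, hky⟩ := hys
    refine ⟨k + t, by rw [map_add, hky, sub_add_cancel], ?_⟩
    simpa using hk
  rcases hP (K.map e) (K.mapQ (K.map e) e (Submodule.le_comap_map e K)) with
    ⟨h, hh⟩ | ⟨D, hD, hDc, h', hh'⟩
  · left
    have hr : ∀ s, h s ∈ LinearMap.range e := fun s =>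
      let ⟨t, ht, _⟩ := hmem _ _ (LinearMap.congr_fun hh s)
      ⟨t, ht⟩
    refine ⟨e'.symm.toLinearMap ∘ₗ h.codRestrict _ hr, LinearMap.ext fun s => ?_⟩
    obtain ⟨t, ht, hts⟩ := hmem _ _ (LinearMap.congr_fun hh s)
    have : e'.symm (h.codRestrict _ hr s) = t := by
      rw [LinearEquiv.symm_apply_eq]
      exact Subtype.ext ht.symm
    simpa [this] using hts
  · right
    have hr : ∀ d : D, (d : E) ∈ LinearMap.range e := fun d =>
      let ⟨t, ht, _⟩ := hmem _ _ (LinearMap.congr_fun hh' d)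
      ⟨t, ht⟩
    have := Submodule.nontrivial_iff_ne_bot.mpr hD
    refine (hE.of_isComplemented hDc).exists_submodule_of_injective
      (e'.symm.toLinearMap ∘ₗ D.subtype.codRestrict _ hr) (e'.symm.injective.comp ?_)
    exact (LinearMap.injective_codRestrict_iff ..).mpr D.injective_subtype

theorem exists_section_or_of_isIZeroModule (hE : IsRelInjective R M E)
    {e : T →ₗ[R] E} (he : Function.Injective e) {K : Submodule R T} [IsSimpleModule R (T ⧸ K)]
    (hI : IsIZeroModule R (E × (T ⧸ K))) :
    (∃ h : (T ⧸ K) →ₗ[R] T, K.mkQ ∘ₗ h = LinearMap.id) ∨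
      ∃ A : Submodule R T, A ≠ ⊥ ∧ IsRelInjective R M A := by
  have hnt := IsSimpleModule.nontrivial R (T ⧸ K)
  let b : T →ₗ[R] E × (T ⧸ K) := e.prod K.mkQ
  have hb : Function.Injective b := fun x y hxy => he (congrArg Prod.fst hxy)
  -- The graph of `T → T/K` together with the proper submodule `E × 0` spans everything.
  have hns : ¬ IsSmallSubmodule (LinearMap.range b) := by
    intro hsmall
    have htop := hsmall (LinearMap.range (LinearMap.inl R E (T ⧸ K))) <| by
      rw [eq_top_iff]
      rintro ⟨x, s⟩ -
      obtain ⟨t, rfl⟩ := K.mkQ_surjective s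
      exact Submodule.mem_sup.mpr ⟨b t, ⟨t, rfl⟩, (x - e t, 0), ⟨x - e t, rfl⟩, by simp [b]⟩
    obtain ⟨s, hs⟩ := exists_ne (0 : T ⧸ K)
    obtain ⟨x, hx⟩ : ((0, s) : E × (T ⧸ K)) ∈ LinearMap.range (LinearMap.inl R E (T ⧸ K)) :=
      htop ▸ trivial
    exact hs (congrArg Prod.snd hx).symm
  obtain ⟨D, hDb, hD, C, hC⟩ := hI _ hns
  let b' := LinearEquiv.ofInjective b hb
  let τ : D →ₗ[R] T := b'.symm.toLinearMap ∘ₗ Submodule.inclusion hDb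
  have hτ : ∀ d : D, b (τ d) = d := fun d =>
    congrArg Subtype.val (b'.apply_symm_apply (Submodule.inclusion hDb d))
  have hτinj : Function.Injective τ := b'.symm.injective.comp (Submodule.inclusion_injective hDb)
  let p := D.projectionOnto C hC
  have hp : ∀ d : D, p d = d := fun d => Submodule.projectionOnto_apply_left hC d
  let σ : (T ⧸ K) →ₗ[R] T := τ ∘ₗ p ∘ₗ LinearMap.inr R E (T ⧸ K)
  -- Schur's lemma: this endomorphism of `T/K` is invertible, which yields a section, or zero.
  rcases (K.mkQ ∘ₗ σ).bijective_or_eq_zero with hbij | hzero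
  · left
    let u := LinearEquiv.ofBijective _ hbij
    refine ⟨σ ∘ₗ u.symm.toLinearMap, LinearMap.ext fun s => u.apply_symm_apply s⟩
  · right
    -- `n` is square-zero, so `D` is a retract of `E` through `p ∘ inl` and `fst ∘ (1 + n)`.
    let n : D →ₗ[R] D := p ∘ₗ LinearMap.inr R E (T ⧸ K) ∘ₗ LinearMap.snd R E (T ⧸ K) ∘ₗ D.subtype
    have hsnd : ∀ d : D, (d : E × (T ⧸ K)).2 = K.mkQ (τ d) := fun d =>
      (congrArg Prod.snd (hτ d)).symm
    have hnn : ∀ d, n (n d) = 0 := by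
      intro d
      have : (n d : E × (T ⧸ K)).2 = 0 := by
        rw [hsnd]
        exact LinearMap.congr_fun hzero (d : E × (T ⧸ K)).2
      change p (0, (n d : E × (T ⧸ K)).2) = 0
      rw [this]
      exact map_zero p
    have hpn : ∀ d : D, p ((d : E × (T ⧸ K)).1, 0) + n d = d := by
      intro d
      change p _ + p (0, (d : E × (T ⧸ K)).2) = d
      rw [← map_add]
      simpa using hp d
    have hDinj : IsRelInjective R M D := by
      refine hE.of_retract (LinearMap.fst R E (T ⧸ K) ∘ₗ D.subtype ∘ₗ (LinearMap.id + n))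
        (p ∘ₗ LinearMap.inl R E (T ⧸ K)) (LinearMap.ext fun d => ?_)
      change p (((d + n d : D) : E × (T ⧸ K)).1, 0) = d
      rw [eq_sub_of_add_eq (hpn (d + n d)), map_add, hnn]
      abel
    have := Submodule.nontrivial_iff_ne_bot.mpr hD
    exact hDinj.exists_submodule_of_injective τ hτinj

/-- If every simple quotient of a module embedded in an `M`-injective module splits or the module
contains a nonzero `M`-injective submodule, then every module subgenerated by `M` is semisimple or
contains a nonzero `M`-injective submodule. -/
theorem isSemisimpleModule_or_exists_isRelInjective {N : Type u} [AddCommGroup N] [Module R N]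
    (hN : IsSubgenerated R M N)
    (H : ∀ (T E : Type u) [AddCommGroup T] [Module R T] [AddCommGroup E] [Module R E]
      (e : T →ₗ[R] E) (K : Submodule R T), Function.Injective e → IsSubgenerated R M T →
      IsSubgenerated R M E → IsRelInjective R M E → IsSimpleModule R (T ⧸ K) →
      (∃ h : (T ⧸ K) →ₗ[R] T, K.mkQ ∘ₗ h = LinearMap.id) ∨
        ∃ A : Submodule R T, A ≠ ⊥ ∧ IsRelInjective R M A) :
    IsSemisimpleModule R N ∨ ∃ A : Submodule R N, A ≠ ⊥ ∧ IsRelInjective R M A := by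
  refine or_iff_not_imp_left.mpr fun hss => ?_
  obtain ⟨T, K, hS, hsplit⟩ := exists_simple_quotient_not_split hss
  obtain ⟨E, _, _, e, he, hEσ, hE⟩ := (hN.submodule T).exists_isRelInjective
  obtain ⟨A, hA, hAinj⟩ := (H T E e K he (hN.submodule T) hEσ hE hS).resolve_left hsplit
  have := Submodule.nontrivial_iff_ne_bot.mpr hA
  exact hAinj.exists_submodule_of_injective (T.subtype ∘ₗ A.subtype)
    (T.injective_subtype.comp A.injective_subtype)

/-- A submodule of `N` that contains a nonzero `M`-injective submodule contains a nonzero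
direct summand of `N`. -/
theorem IsSubgenerated.exists_isComplemented_le {N : Type u} [AddCommGroup N] [Module R N]
    (hN : IsSubgenerated R M N) {B : Submodule R N} {A : Submodule R B} (hA : A ≠ ⊥)
    (hAinj : IsRelInjective R M A) : ∃ D ≤ B, D ≠ ⊥ ∧ IsComplemented D := by
  let e := Submodule.equivSubtypeMap B A
  refine ⟨A.map B.subtype, Submodule.map_subtype_le B A, ?_, ?_⟩
  · rw [← Submodule.map_bot B.subtype]
    exact (Submodule.map_injective_of_injective B.injective_subtype).ne hA
  · exact IsRelInjective.isComplemented hN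
      (hAinj.of_retract e.symm.toLinearMap e.toLinearMap (by ext; simp))

theorem isIZeroModule_of_semisimple_or_isRelInjective {N : Type u} [AddCommGroup N] [Module R N]
    (hN : IsSubgenerated R M N)
    (H : ∀ B : Submodule R N, IsSemisimpleModule R B ∨
      ∃ A : Submodule R B, A ≠ ⊥ ∧ IsRelInjective R M A) : IsIZeroModule R N := by
  intro B hB
  rcases H B with hss | ⟨A, hA, hAinj⟩
  · simp only [IsSmallSubmodule, not_forall] at hB
    obtain ⟨C, hBC, hC⟩ := hB
    -- Since `B + C = N`, a complement of `B ∩ C` in the semisimple `B` is a complement of `C` in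
    -- `N`.
    obtain ⟨D, hD⟩ := exists_isCompl (C.comap B.subtype)
    have hDB : D.map B.subtype ≤ B := Submodule.map_subtype_le B D
    have hsup : B ⊓ C ⊔ D.map B.subtype = B := by
      have := congrArg (Submodule.map B.subtype) hD.sup_eq_top
      rwa [Submodule.map_sup, Submodule.map_comap_subtype, Submodule.map_subtype_top] at this
    have hinf : B ⊓ C ⊓ D.map B.subtype = ⊥ := by
      have := congrArg (Submodule.map B.subtype) hD.inf_eq_bot
      rwa [Submodule.map_inf _ B.injective_subtype, Submodule.map_comap_subtype,
        Submodule.map_bot] at this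
    have hcod : C ⊔ D.map B.subtype = ⊤ := by
      rw [eq_top_iff, ← hBC]
      refine sup_le ?_ le_sup_left
      conv_lhs => rw [← hsup]
      exact sup_le_sup_right inf_le_right _
    refine ⟨D.map B.subtype, hDB, ?_, C, ?_, codisjoint_iff.mpr (sup_comm C _ ▸ hcod)⟩
    · intro h
      rw [h, sup_bot_eq] at hcod
      exact hC hcod
    · rw [disjoint_iff, ← hinf]
      refine le_antisymm ?_ ?_
      · exact le_inf (le_inf (inf_le_left.trans hDB) inf_le_right) inf_le_left
      · exact le_inf inf_le_right (inf_le_left.trans inf_le_right)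
  · exact hN.exists_isComplemented_le hA hAinj

theorem isAlmostRelProjective_of_semisimple_or_isRelInjective {N S : Type u} [AddCommGroup N]
    [Module R N] [AddCommGroup S] [Module R S] [IsSimpleModule R S] (hN : IsSubgenerated R M N)
    (H : ∀ B : Submodule R N, IsSemisimpleModule R B ∨
      ∃ A : Submodule R B, A ≠ ⊥ ∧ IsRelInjective R M A) : IsAlmostRelProjective R N S := by
  intro K f
  rcases f.injective_or_eq_zero with hf | rfl
  swap
  · exact .inl ⟨0, LinearMap.comp_zero _⟩
  let e := LinearEquiv.ofInjective f hf
  -- `B` maps onto `S` through `q`: a section of `q` lifts `f`, while a summand of `N` inside `B`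
  -- maps to `S` by `q`.
  let B := (LinearMap.range f).comap K.mkQ
  let q : B →ₗ[R] S := e.symm.toLinearMap ∘ₗ K.mkQ.restrict fun _ hx => hx
  have hq : ∀ x : B, f (q x) = K.mkQ x := fun x =>
    congrArg Subtype.val (e.apply_symm_apply (K.mkQ.restrict (fun _ hx => hx) x))
  rcases H B with hss | ⟨A, hA, hAinj⟩
  · left
    have hqs : Function.Surjective q := by
      intro s
      obtain ⟨x, hx⟩ := K.mkQ_surjective (f s)
      exact ⟨⟨x, s, hx.symm⟩, hf ((hq _).trans hx)⟩
    obtain ⟨h, hh⟩ := IsSemisimpleModule.lifting_property q hqs LinearMap.id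
    refine ⟨B.subtype ∘ₗ h, LinearMap.ext fun s => ?_⟩
    exact (hq (h s)).symm.trans (congrArg f (LinearMap.congr_fun hh s))
  · right
    obtain ⟨D, hDB, hD, hDc⟩ := hN.exists_isComplemented_le hA hAinj
    exact ⟨D, hD, hDc, q ∘ₗ Submodule.inclusion hDB, LinearMap.ext fun d => (hq ⟨d, hDB d.2⟩).symm⟩

end SubgeneratedModules

theorem theorem1p1 {R : Type u} [Ring R] (M : Type u) [AddCommGroup M] [Module R M] :
    List.TFAE [
      ∀ (S : Type u) [AddCommGroup S] [Module R S],
        IsSubgenerated R M S → IsSimpleModule R S → IsAlmostProjectiveIn R M S,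
      ∀ (N : Type u) [AddCommGroup N] [Module R N],
        IsSubgenerated R M N →
          IsSemisimpleModule R N ∨
            ∃ A : Submodule R N, A ≠ ⊥ ∧ IsRelInjective R M A,
      ∀ (N : Type u) [AddCommGroup N] [Module R N],
        IsSubgenerated R M N → IsIZeroModule R N] := by
  tfae_have 1 → 2 := fun h N _ _ hN =>
    isSemisimpleModule_or_exists_isRelInjective hN fun T E _ _ _ _ e K he hT hEσ hE hS =>
      exists_section_or_of_isAlmostRelProjective hE he (h (T ⧸ K) (hT.quotient K) hS E hEσ)
  tfae_have 2 → 1 := fun h S _ _ _ _ N _ _ hN =>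
    isAlmostRelProjective_of_semisimple_or_isRelInjective hN fun B => h B (hN.submodule B)
  tfae_have 2 → 3 := fun h N _ _ hN =>
    isIZeroModule_of_semisimple_or_isRelInjective hN fun B => h B (hN.submodule B)
  tfae_have 3 → 2 := fun h N _ _ hN =>
    isSemisimpleModule_or_exists_isRelInjective hN fun T E _ _ _ _ e K he hT hEσ hE _ =>
      exists_section_or_of_isIZeroModule hE he (h (E × (T ⧸ K)) (hEσ.prod (hT.quotient K)))
  tfae_finish
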